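/- \textbf{Setting.} Fix $d_v\in\mathbb{N}$ and let $\mathcal C=(\mathcal C_t)_{t\ge 1}$ be a sequence of binary linear codes, $\mathcal C_t$ given by a parity check matrix $H=H_t\in\mathbb F_2^{m\times n}$ ($m=m_t$, $n=n_t\to\infty$) each of whose columns has exactly $d_v$ ones. The factor graph has variable nodes $1,\dots,n$, check nodes $1,\dots,m$, and an edge $ij$ iff $H_{ji}=1$; $N(\cdot)$ denotes neighbourhoods. Put $\mathcal P=\bigcap_j \mathrm{conv}\{x\in\{0,1\}^n: h_j^Tx=0 \bmod 2\}$, with $h_j^T$ the $j$-th row of $H$. \textbf{Algorithm} (parameters $\ell\in\mathbb N$ and $\lambda_1<0<\lambda_2$). Given a received word $y\in\{0,1\}^n$: (1) let $x^{(p)}$ minimize $\|x-y\|_1$ over $\mathcal P$; if $x^{(p)}$ is integral, output it. (2) Otherwise let $L$ index the $\ell$ entries of $y-x^{(p)}$ that are largest in absolute value (all entries if $\ell>n$), and output a minimizer over $\mathcal P$ of $\lambda_1\|(x-y)_L\|_1+\lambda_2\|(x-y)_{L^c}\|_1$. The algorithm \emph{corrects} an error set $S$ if, for every codeword $c$, when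 $c$ is sent and exactly the bits in $S$ are flipped, the output is always $c$, whichever minimizers are used and however ties are broken. \textbf{Certificates.} For an error set $S$ put $\gamma_i=-1$ for $i\in S$ and $\gamma_i=1$ for $i\notin S$. Feasible dual variables for $S$ are reals $\tau_{ij}$ on the edges with $\tau_{ij}+\tau_{i'j}\ge0$ for every check node $j$ and distinct $i,i'\in N(j)$, and $\sum_{j\in N(i)}\tau_{ij}<\gamma_i$ for all $i$. Let $M$ be a set of edges no two of which share a check node, and let $x>0$. The labelling $\tau^{M,x}$ gives, at each check node matched by $M$ to some $i\in S$, the value $-x$ to the edge towards $i$ and $x$ to the other edges at that check node; all remaining edges get $0$. \begin{itemize} \item $S$ is \emph{strongly certified} if, for some $\delta\in\mathbb R$, $\lambda=2-2\delta+1/d_v$, $M$ and $x$, $M$ is a $(\delta,\lambda)$-matching of $S$ and $\tau^{M,x}$ is feasible for $S$. Here $M$ is a $(\delta,\lambda)$-matching of $S$ if every $i\in S$ lies on at least $\delta d_v$ edges of $M$, and every $i\notin S$ with $|N(i)\cap N(S)|\ge(1-\lambda)d_v$ lies on at least $\lambda d_v$ edges of $M$. \item $S$ is \emph{weakly certified}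 if, for some integers $p\ge0$ and $0\le q\le d_v$ with $2p-d_v>d_v-q$, some $M$ and some $x$, $M$ is a $(p,q)$-matching on $S$ and $\tau^{M,x}$ is feasible for $S$. Here $M$ is a $(p,q)$-matching on $S$ if all its edges end in $S$, every $i\in S$ lies on exactly $p$ edges of $M$, and every $i\notin S$ is adjacent to at least $\max\{q-d_v+|N(i)\cap N(S)|,0\}$ check nodes of $N(S)$ that are not covered by $M$. \end{itemize} Let $p^*_{sd}$ be the supremum of all $p\in[0,1]$ such that, for all large $t$, every $S\subseteq\{1,\dots,n\}$ of size $\lfloor pn\rfloor$ is strongly certified. Let $p^*_{wd}$ be the supremum of all $p\in[0,1]$ such that the fraction of the sets $S$ of size $\lfloor pn\rfloor$ that are weakly certified tends to $1$ as $t\to\infty$. (The supremum of the empty set is taken to be $0$.) \textbf{Theorem.} For every such $\mathcal C$ there are $\varepsilon_1,\varepsilon_2>0$ and $\lambda_1<0<\lambda_2$ such that: \begin{enumerate} \item for all large $t$, the algorithm with $\ell=\lfloor(1+\varepsilon_1)p^*_{sd}n\rfloor$ corrects every error set of size at most $(1+\varepsilon_1)p^*_{sd}n$; \item if $p^*_{sd}>0$,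 then the algorithm with $\ell=\lfloor(1+\varepsilon_2)p^*_{wd}n\rfloor$ corrects almost all error sets of size $(1+\varepsilon_2)p^*_{wd}n$: for all integers $0\le k_t\le(1+\varepsilon_2)p^*_{wd}n_t$, the fraction of the error sets of size $k_t$ (among the subsets of $\{1,\dots,n_t\}$ of that size) that it fails to correct tends to $0$ as $t\to\infty$ (the fraction counts as $0$ if there are no such sets). \end{enumerate} -/

import Mathlib

open Filter Topology

noncomputable section

namespace ReweightedLP

variable {m n : ℕ}

/-! ### Codes, the relaxed polytope, the bit flipping channel -/

/-- The codewords of the code with parity check matrix `H`. -/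
def IsCodeword (H : Matrix (Fin m) (Fin n) (ZMod 2)) (c : Fin n → ZMod 2) : Prop :=
  H.mulVec c = 0

/-- A binary word seen as a `0/1` vector in `ℝⁿ`. -/
def toReal (c : Fin n → ZMod 2) : Fin n → ℝ := fun i => ((c i).val : ℝ)

/-- The polytope `𝒫 = ⋂ⱼ conv(𝒞ⱼ)`, where `𝒞ⱼ` consists of the binary words that satisfy
the `j`-th parity check. -/
def polytope (H : Matrix (Fin m) (Fin n) (ZMod 2)) : Set (Fin n → ℝ) :=
  ⋂ j : Fin m, convexHull ℝ (toReal '' {c : Fin n → ZMod 2 | H j ⬝ᵥ c = 0})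

/-- The word received when `c` is sent and exactly the bits in `S` are flipped. -/
def received (c : Fin n → ZMod 2) (S : Finset (Fin n)) : Fin n → ZMod 2 :=
  fun i => if i ∈ S then c i + 1 else c i

/-- The minimizers of `f` over `A`. -/
def minimizers (A : Set (Fin n → ℝ)) (f : (Fin n → ℝ) → ℝ) : Set (Fin n → ℝ) :=
  {x | x ∈ A ∧ ∀ z ∈ A, f x ≤ f z}

/-- `‖x_L‖₁`. -/
def l1On (L : Finset (Fin n)) (x : Fin n → ℝ) : ℝ := ∑ i ∈ L, |x i|

/-! ### The two-step decoder -/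

/-- The solutions of the LP decoder for the received vector `y`:
minimize `‖x - y‖₁` over the polytope. -/
def lpSolutions (H : Matrix (Fin m) (Fin n) (ZMod 2)) (y : Fin n → ℝ) : Set (Fin n → ℝ) :=
  minimizers (polytope H) fun x => l1On Finset.univ (x - y)

/-- The solutions of the reweighted LP:
minimize `lam₁ ‖(x - y)_L‖₁ + lam₂ ‖(x - y)_{Lᶜ}‖₁` over the polytope. -/
def weightedSolutions (H : Matrix (Fin m) (Fin n) (ZMod 2)) (lam₁ lam₂ : ℝ)
    (L : Finset (Fin n)) (y : Fin n → ℝ) : Set (Fin n → ℝ) :=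
  minimizers (polytope H) fun x => lam₁ * l1On L (x - y) + lam₂ * l1On Lᶜ (x - y)

def IsIntegral (x : Fin n → ℝ) : Prop := ∀ i, x i = 0 ∨ x i = 1

/-- `L` indexes `ℓ` entries of `d` that are largest in absolute value
(all the entries if `ℓ` exceeds the length); ties may be broken in any way. -/
def IsLargestEntries (ℓ : ℕ) (d : Fin n → ℝ) (L : Finset (Fin n)) : Prop :=
  L.card = min ℓ n ∧ ∀ i ∈ L, ∀ j ∉ L, |d j| ≤ |d i|

/-- All possible outputs of the reweighted decoder on the received vector `y`: run the LP decoder;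
if its solution is integral, return it; otherwise let `L` index the `ℓ` entries in which the
solution deviates most from `y`, and return a solution of the reweighted LP. All choices of an
optimal solution and all ways of breaking ties are allowed. -/
def decoderOutputs (H : Matrix (Fin m) (Fin n) (ZMod 2)) (ℓ : ℕ) (lam₁ lam₂ : ℝ)
    (y : Fin n → ℝ) : Set (Fin n → ℝ) :=
  {z | ∃ xp ∈ lpSolutions H y,
    (IsIntegral xp ∧ z = xp) ∨
    (¬ IsIntegral xp ∧ ∃ L, IsLargestEntries ℓ (y - xp) L ∧
      z ∈ weightedSolutions H lam₁ lam₂ L y)}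

/-- The reweighted decoder corrects the error set `S`: whatever codeword was sent, the decoder
returns that codeword, and can return nothing else. -/
def Corrects (H : Matrix (Fin m) (Fin n) (ZMod 2)) (ℓ : ℕ) (lam₁ lam₂ : ℝ)
    (S : Finset (Fin n)) : Prop :=
  ∀ c, IsCodeword H c → decoderOutputs H ℓ lam₁ lam₂ (toReal (received c S)) = {toReal c}

/-! ### The factor graph and feasible dual variables -/

/-- The check nodes adjacent to the variable node `i` in the factor graph. -/
def checksOf (H : Matrix (Fin m) (Fin n) (ZMod 2)) (i : Fin n) : Finset (Fin m) :=
  Finset.univ.filter fun j => H j i ≠ 0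

/-- `N(S)`, the check nodes adjacent to some variable node in `S`. -/
def nbrs (H : Matrix (Fin m) (Fin n) (ZMod 2)) (S : Finset (Fin n)) : Finset (Fin m) :=
  S.biUnion (checksOf H)

/-- Every variable node has degree `dv`. -/
def VariableRegular (H : Matrix (Fin m) (Fin n) (ZMod 2)) (dv : ℕ) : Prop :=
  ∀ i, (checksOf H i).card = dv

/-- The likelihood vector of the error set `S`: `-1` on `S` and `1` off `S`. -/
def likelihood (S : Finset (Fin n)) : Fin n → ℝ := fun i => if i ∈ S then -1 else 1

/-- Feasible dual variables for the likelihood vector `γ`. The second inequality is strict: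
this is what makes the all-zero word the unique optimum. -/
structure DualFeasible (H : Matrix (Fin m) (Fin n) (ZMod 2)) (γ : Fin n → ℝ)
    (τ : Fin n → Fin m → ℝ) : Prop where
  check : ∀ j i i', H j i ≠ 0 → H j i' ≠ 0 → i ≠ i' → 0 ≤ τ i j + τ i' j
  variable_lt : ∀ i, ∑ j ∈ checksOf H i, τ i j < γ i

/-- A set of edges `(variable node, check node)` of the factor graph, no two of which share a
check node. -/
def IsCheckMatching (H : Matrix (Fin m) (Fin n) (ZMod 2)) (M : Finset (Fin n × Fin m)) : Prop :=
  (∀ e ∈ M, H e.2 e.1 ≠ 0) ∧ ∀ e ∈ M, ∀ e' ∈ M, e.2 = e'.2 → e = e'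

/-- The number of edges of `M` at the variable node `i`. -/
def matchDegree (M : Finset (Fin n × Fin m)) (i : Fin n) : ℕ := (M.filter fun e => e.1 = i).card

open Classical in
/-- The dual variables that a matching `M` puts on the edges: at a check node that is matched to
`i ∈ S`, the edge to `i` gets `-x` and the other edges get `x`; all other edges get `0`. -/
def matchingLabel (S : Finset (Fin n)) (M : Finset (Fin n × Fin m)) (x : ℝ) :
    Fin n → Fin m → ℝ :=
  fun i j => if i ∈ S ∧ (i, j) ∈ M then -x else if ∃ i' ∈ S, (i', j) ∈ M then x else 0

/-- A `(δ, lam)`-matching of `S`: every node of `S` has at least `δ dv` edges of `M`, and every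
node off `S` that has at least `(1 - lam) dv` neighbours in `N(S)` has at least `lam dv` edges
of `M`. -/
structure IsDeltaLambdaMatching (H : Matrix (Fin m) (Fin n) (ZMod 2)) (dv : ℕ)
    (S : Finset (Fin n)) (δ lam : ℝ) (M : Finset (Fin n × Fin m)) : Prop where
  matching : IsCheckMatching H M
  on_set : ∀ i ∈ S, δ * dv ≤ (matchDegree M i : ℝ)
  off_set : ∀ i ∉ S, (1 - lam) * dv ≤ ((checksOf H i ∩ nbrs H S).card : ℝ) →
    lam * dv ≤ (matchDegree M i : ℝ)

/-- A `(p, q)`-matching on `S`: every node of `S` is matched with `p` check nodes, all of them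
distinct, and every node `i` off `S` is connected with at least `max {q - dv + |N(i) ∩ N(S)|, 0}`
check nodes in `N(S)` that are not matched (the subtraction of natural numbers truncates). -/
structure IsPQMatching (H : Matrix (Fin m) (Fin n) (ZMod 2)) (dv : ℕ)
    (S : Finset (Fin n)) (p q : ℕ) (M : Finset (Fin n × Fin m)) : Prop where
  matching : IsCheckMatching H M
  inside : ∀ e ∈ M, e.1 ∈ S
  on_set : ∀ i ∈ S, matchDegree M i = p
  off_set : ∀ i ∉ S, (q + (checksOf H i ∩ nbrs H S).card) - dv ≤
    ((checksOf H i ∩ nbrs H S) \ M.image Prod.snd).card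

/-- `S` has feasible dual variables that come from a `(δ, 2 - 2δ + 1/dv)`-matching. -/
def StrongCertified (H : Matrix (Fin m) (Fin n) (ZMod 2)) (dv : ℕ) (S : Finset (Fin n)) : Prop :=
  ∃ (δ x : ℝ) (M : Finset (Fin n × Fin m)),
    0 < x ∧ IsDeltaLambdaMatching H dv S δ (2 - 2 * δ + 1 / dv) M ∧
    DualFeasible H (likelihood S) (matchingLabel S M x)

/-- `S` has feasible dual variables that come from a `(p, q)`-matching with
`2 p - dv > dv - q ≥ 0`. -/
def WeakCertified (H : Matrix (Fin m) (Fin n) (ZMod 2)) (dv : ℕ) (S : Finset (Fin n)) : Prop :=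
  ∃ (p q : ℕ) (x : ℝ) (M : Finset (Fin n × Fin m)),
    0 < x ∧ q ≤ dv ∧ 2 * dv < 2 * p + q ∧ IsPQMatching H dv S p q M ∧
    DualFeasible H (likelihood S) (matchingLabel S M x)

/-! ### Thresholds of a sequence of codes -/

open Classical in
/-- The fraction of the `k`-element subsets of `{1, …, n}` for which `Q` fails. -/
def failFraction (n k : ℕ) (Q : Finset (Fin n) → Prop) : ℝ :=
  (((Finset.univ.powersetCard k).filter fun S => ¬ Q S).card : ℝ) / (n.choose k : ℝ)

/-- The strong threshold `p*_sd` of a sequence of codes with variable degree `dv`: the largest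
fraction `p` such that every set of size `p N` is certified. -/
def strongThreshold (dv : ℕ) (M N : ℕ → ℕ)
    (H : ∀ t, Matrix (Fin (M t)) (Fin (N t)) (ZMod 2)) : ℝ :=
  sSup {p : ℝ | 0 ≤ p ∧ p ≤ 1 ∧ ∀ᶠ t in atTop, ∀ S : Finset (Fin (N t)),
    S.card = ⌊p * N t⌋₊ → StrongCertified (H t) dv S}

/-- The weak threshold `p*_wd` of a sequence of codes with variable degree `dv`: the largest
fraction `p` such that almost all sets of size `p N` are certified. -/
def weakThreshold (dv : ℕ) (M N : ℕ → ℕ)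
    (H : ∀ t, Matrix (Fin (M t)) (Fin (N t)) (ZMod 2)) : ℝ :=
  sSup {p : ℝ | 0 ≤ p ∧ p ≤ 1 ∧
    Tendsto (fun t => failFraction (N t) ⌊p * N t⌋₊ (WeakCertified (H t) dv)) atTop (𝓝 0)}

end ReweightedLP

end

/-!
Reflecting the cube in the coordinates where a codeword `c` is `1` preserves the polytope and moves
`c` to `0`, so `|x - c|` lies in the fundamental cone for every feasible point `x`. A certificate
for `S` bounds the mass on `S` of a vector of that cone by its mass off `S`. Its labels are integer
multiples of one number, so the bound improves to a factor `C > 1` that depends only on the degree;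
this property passes to subsets and is robust in the way of the null space property of compressed
sensing. An error set `S` of size slightly beyond a threshold contains a certified set that misses
only a small fraction of the nodes, hence every LP solution is close to `c` in `ℓ¹`, and the set `L`
of largest deviations differs from `S` in few nodes. With the weights `-1` and `1` the second
program is an ordinary LP decoder with error set `L ∆ S`, which lies well below the strong
threshold, so it returns `c`. For almost all error sets, the local LYM inequality carries fractions
of bad sets from one size to a larger one.
-/

namespace ReweightedLP

variable {m n : ℕ} {H : Matrix (Fin m) (Fin n) (ZMod 2)} {S S' : Finset (Fin n)}
  {w : Fin n → ℝ} {C : ℝ} {dv : ℕ}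

/-! ### The fundamental cone -/

/-- `N(j)`, the variable nodes adjacent to the check node `j` in the factor graph. -/
def variablesOf (H : Matrix (Fin m) (Fin n) (ZMod 2)) (j : Fin m) : Finset (Fin n) :=
  Finset.univ.filter fun i => H j i ≠ 0

@[simp]
theorem mem_variablesOf {j : Fin m} {i : Fin n} : i ∈ variablesOf H j ↔ H j i ≠ 0 := by
  simp [variablesOf]

/-- `w` lies in the fundamental cone of the factor graph, the cone that the polytope spans at the
zero codeword. -/
structure InFundamentalCone (H : Matrix (Fin m) (Fin n) (ZMod 2)) (w : Fin n → ℝ) : Prop where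
  nonneg : ∀ i, 0 ≤ w i
  le_sum_erase : ∀ j, ∀ i ∈ variablesOf H j, w i ≤ ∑ k ∈ (variablesOf H j).erase i, w k

/-- The fundamental cone property `FCP(S, C)`: on the fundamental cone, the mass off `S` is at
least `C` times the mass on `S`. It plays the role of the null space property of compressed
sensing. -/
def FundamentalConeProperty (H : Matrix (Fin m) (Fin n) (ZMod 2)) (S : Finset (Fin n)) (C : ℝ) :
    Prop :=
  ∀ w, InFundamentalCone H w → C * ∑ i ∈ S, w i ≤ ∑ i ∈ Sᶜ, w i

theorem FundamentalConeProperty.mono (h : FundamentalConeProperty H S' C) (hC : 0 ≤ C)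
    (hS : S ⊆ S') : FundamentalConeProperty H S C := fun w hw =>
  calc C * ∑ i ∈ S, w i ≤ C * ∑ i ∈ S', w i := mul_le_mul_of_nonneg_left
        (Finset.sum_le_sum_of_subset_of_nonneg hS fun i _ _ => hw.nonneg i) hC
    _ ≤ ∑ i ∈ S'ᶜ, w i := h w hw
    _ ≤ ∑ i ∈ Sᶜ, w i := Finset.sum_le_sum_of_subset_of_nonneg (Finset.compl_subset_compl.2 hS)
        fun i _ _ => hw.nonneg i

theorem FundamentalConeProperty.eq_zero (h : FundamentalConeProperty H S C) (hC : 1 < C)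
    (hw : InFundamentalCone H w) (hle : ∑ i ∈ Sᶜ, w i ≤ ∑ i ∈ S, w i) : w = 0 := by
  have hcone := h w hw
  have hnonneg : 0 ≤ ∑ i ∈ S, w i := Finset.sum_nonneg fun i _ => hw.nonneg i
  have hon : ∑ i ∈ S, w i ≤ 0 := by nlinarith [hnonneg]
  have hsum : ∑ i, w i ≤ 0 := by
    rw [← Finset.sum_add_sum_compl S]
    linarith
  have hzero := (Finset.sum_eq_zero_iff_of_nonneg fun i _ => hw.nonneg i).1
    (hsum.antisymm (Finset.sum_nonneg fun i _ => hw.nonneg i))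
  exact funext fun i => hzero i (Finset.mem_univ i)

theorem FundamentalConeProperty.neZero (h : FundamentalConeProperty H S C) (hC : 0 < C)
    (hS : S.Nonempty) : NeZero m := by
  refine ⟨?_⟩
  rintro rfl
  obtain ⟨i, hi⟩ := hS
  have hle := h (Pi.single i 1)
    ⟨fun k => Pi.single_nonneg (α := fun _ => ℝ) |>.2 zero_le_one k, fun j => j.elim0⟩
  simp only [Finset.sum_pi_single', hi, if_true, Finset.mem_compl, not_true, if_false] at hle
  linarith

/-! ### Certificates imply the fundamental cone property -/

theorem InFundamentalCone.sum_dual_mul_nonneg (hw : InFundamentalCone H w)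
    {τ : Fin n → Fin m → ℝ}
    (hτ : ∀ j i i', H j i ≠ 0 → H j i' ≠ 0 → i ≠ i' → 0 ≤ τ i j + τ i' j) :
    0 ≤ ∑ i, (∑ j ∈ checksOf H i, τ i j) * w i := by
  have hcheck : ∀ j, 0 ≤ ∑ i ∈ variablesOf H j, τ i j * w i := by
    intro j
    by_cases hneg : ∃ i₀ ∈ variablesOf H j, τ i₀ j < 0
    · obtain ⟨i₀, hi₀, hlt⟩ := hneg
      calc 0 ≤ -τ i₀ j * (∑ i ∈ (variablesOf H j).erase i₀, w i - w i₀) :=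
            mul_nonneg (by linarith) (sub_nonneg.2 (hw.le_sum_erase j i₀ hi₀))
        _ = τ i₀ j * w i₀ + ∑ i ∈ (variablesOf H j).erase i₀, -τ i₀ j * w i := by
            rw [← Finset.mul_sum]; ring
        _ ≤ τ i₀ j * w i₀ + ∑ i ∈ (variablesOf H j).erase i₀, τ i j * w i := by
            gcongr with i hi
            · exact hw.nonneg i
            · obtain ⟨hne, hmem⟩ := Finset.mem_erase.1 hi
              linarith [hτ j i i₀ (mem_variablesOf.1 hmem) (mem_variablesOf.1 hi₀) hne]
        _ = ∑ i ∈ variablesOf H j, τ i j * w i := Finset.add_sum_erase _ (fun i => τ i j * w i) hi₀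
    · push Not at hneg
      exact Finset.sum_nonneg fun i hi => mul_nonneg (hneg i hi) (hw.nonneg i)
  calc 0 ≤ ∑ j, ∑ i ∈ variablesOf H j, τ i j * w i := Finset.sum_nonneg fun j _ => hcheck j
    _ = ∑ i, (∑ j ∈ checksOf H i, τ i j) * w i := by
        simp_rw [Finset.sum_mul, variablesOf, checksOf, Finset.sum_filter]
        exact Finset.sum_comm

theorem exists_int_separating_likelihood {x : ℝ} (hx : 0 < x) {σ : Fin n → ℤ}
    (hσ : ∀ i, x * σ i < likelihood S i) {d : ℕ} (hd : ∀ i, σ i ≤ d) :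
    ∃ K : ℤ, 0 ≤ K ∧ K ≤ d ∧ (∀ i ∈ S, σ i ≤ -(K + 1)) ∧ ∀ i ∉ S, σ i ≤ K := by
  have hceil : 0 < ⌈x⁻¹⌉ := Int.ceil_pos.2 (inv_pos.2 hx)
  refine ⟨min (⌈x⁻¹⌉ - 1) d, by omega, min_le_right _ _, fun i hi => ?_, fun i hi => ?_⟩
  · have hlt := hσ i
    rw [likelihood, if_pos hi] at hlt
    have hle : ⌈x⁻¹⌉ ≤ -σ i := Int.ceil_le.2 <| by
      rw [inv_le_iff_one_le_mul₀' hx]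
      push_cast
      linarith
    omega
  · have hlt := hσ i
    rw [likelihood, if_neg hi] at hlt
    have hle : σ i < ⌈x⁻¹⌉ := Int.lt_ceil.2 <| by
      rwa [inv_eq_one_div, lt_div_iff₀' hx]
    exact le_min (by omega) (hd i)

theorem one_add_one_div_mul_le {a b k d : ℝ} (hd : 0 ≤ d) (hb : 0 ≤ b) (hk : 0 ≤ k) (hkd : k ≤ d)
    (h : (k + 1) * a ≤ k * b) : (1 + 1 / (d + 1)) * a ≤ b := by
  have hab : a ≤ b := le_of_mul_le_mul_left (by linarith : (k + 1) * a ≤ (k + 1) * b) (by linarith)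
  have hgap : a ≤ (d + 1) * (b - a) :=
    calc a ≤ k * (b - a) := by linarith
      _ ≤ (d + 1) * (b - a) := mul_le_mul_of_nonneg_right (by linarith) (sub_nonneg.2 hab)
  have hdiv : a / (d + 1) ≤ b - a := (div_le_iff₀' (by positivity)).2 hgap
  calc (1 + 1 / (d + 1)) * a = a + a / (d + 1) := by ring
    _ ≤ b := by linarith

/-- Dual feasibility alone only yields `∑ i ∈ S, w i < ∑ i ∈ Sᶜ, w i` on the cone. For labels in
`x * ℤ` the label sums lie in `x * ℤ` as well, so the strict inequalities leave a gap of `x`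
between the nodes on and off `S`, and this gap is what makes `C > 1`. -/
theorem DualFeasible.fundamentalConeProperty_of_int {x : ℝ} (hx : 0 < x)
    {s : Fin n → Fin m → ℤ} (hf : DualFeasible H (likelihood S) fun i j => x * s i j)
    (hs : ∀ i j, s i j ≤ 1) (hdeg : ∀ i, (checksOf H i).card ≤ dv) :
    FundamentalConeProperty H S (1 + 1 / (dv + 1)) := by
  intro w hw
  set σ : Fin n → ℤ := fun i => ∑ j ∈ checksOf H i, s i j with hσ
  have hsum : ∀ i, ∑ j ∈ checksOf H i, x * (s i j : ℝ) = x * σ i := fun i => by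
    simp only [hσ, Int.cast_sum, Finset.mul_sum]
  have hσd : ∀ i, σ i ≤ dv := fun i =>
    (Finset.sum_le_card_nsmul _ _ 1 fun j _ => hs i j).trans (by simpa using hdeg i)
  obtain ⟨K, hK0, hKd, hon, hoff⟩ :=
    exists_int_separating_likelihood hx (fun i => hsum i ▸ hf.variable_lt i) hσd
  have hpair : 0 ≤ ∑ i, (σ i : ℝ) * w i := by
    have h := hw.sum_dual_mul_nonneg hf.check
    simp only [hsum, mul_assoc, ← Finset.mul_sum] at h
    exact nonneg_of_mul_nonneg_right h hx
  have hS : ∑ i ∈ S, (σ i : ℝ) * w i ≤ -(K + 1) * ∑ i ∈ S, w i := by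
    rw [Finset.mul_sum]
    exact Finset.sum_le_sum fun i hi =>
      mul_le_mul_of_nonneg_right (by exact_mod_cast hon i hi) (hw.nonneg i)
  have hSc : ∑ i ∈ Sᶜ, (σ i : ℝ) * w i ≤ K * ∑ i ∈ Sᶜ, w i := by
    rw [Finset.mul_sum]
    exact Finset.sum_le_sum fun i hi =>
      mul_le_mul_of_nonneg_right (by exact_mod_cast hoff i (Finset.mem_compl.1 hi)) (hw.nonneg i)
  rw [← Finset.sum_add_sum_compl S] at hpair
  have hB : 0 ≤ ∑ i ∈ Sᶜ, w i := Finset.sum_nonneg fun i _ => hw.nonneg i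
  exact one_add_one_div_mul_le (k := K) (Nat.cast_nonneg dv) hB (by exact_mod_cast hK0)
    (by exact_mod_cast hKd) (by linarith)

theorem exists_int_matchingLabel_eq_mul (S : Finset (Fin n)) (M : Finset (Fin n × Fin m)) (x : ℝ)
    (i : Fin n) (j : Fin m) : ∃ s : ℤ, s ≤ 1 ∧ matchingLabel S M x i j = x * s := by
  unfold matchingLabel
  split_ifs
  exacts [⟨-1, by norm_num, by simp⟩, ⟨1, le_rfl, by simp⟩, ⟨0, zero_le_one, by simp⟩]

theorem DualFeasible.fundamentalConeProperty {M : Finset (Fin n × Fin m)} {x : ℝ}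
    (hf : DualFeasible H (likelihood S) (matchingLabel S M x)) (hx : 0 < x)
    (hdeg : ∀ i, (checksOf H i).card ≤ dv) :
    FundamentalConeProperty H S (1 + 1 / (dv + 1)) := by
  choose s hs hlabel using exists_int_matchingLabel_eq_mul S M x
  rw [funext₂ hlabel] at hf
  exact hf.fundamentalConeProperty_of_int hx hs hdeg

theorem StrongCertified.fundamentalConeProperty (h : StrongCertified H dv S)
    (hdeg : ∀ i, (checksOf H i).card ≤ dv) : FundamentalConeProperty H S (1 + 1 / (dv + 1)) := by
  obtain ⟨_, _, _, hx, -, hf⟩ := h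
  exact hf.fundamentalConeProperty hx hdeg

theorem WeakCertified.fundamentalConeProperty (h : WeakCertified H dv S)
    (hdeg : ∀ i, (checksOf H i).card ≤ dv) : FundamentalConeProperty H S (1 + 1 / (dv + 1)) := by
  obtain ⟨_, _, _, _, hx, -, -, -, hf⟩ := h
  exact hf.fundamentalConeProperty hx hdeg

theorem dualFeasible_likelihood_empty (H : Matrix (Fin m) (Fin n) (ZMod 2)) (x : ℝ) :
    DualFeasible H (likelihood ∅) (matchingLabel ∅ ∅ x) := by
  constructor <;> simp [matchingLabel, likelihood]

theorem strongCertified_empty (H : Matrix (Fin m) (Fin n) (ZMod 2)) (dv : ℕ) :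
    StrongCertified H dv ∅ := by
  have hle : (2 - 2 * 2 + 1 / (dv : ℝ)) * dv ≤ 0 := by
    rcases eq_or_ne dv 0 with rfl | hdv
    · simp
    · have : (1 : ℝ) ≤ dv := by exact_mod_cast Nat.one_le_iff_ne_zero.2 hdv
      field_simp
      linarith
  exact ⟨2, 1, ∅, one_pos, ⟨by simp [IsCheckMatching], by simp,
    fun i _ _ => hle.trans (Nat.cast_nonneg _)⟩, dualFeasible_likelihood_empty H 1⟩

theorem weakCertified_empty (H : Matrix (Fin m) (Fin n) (ZMod 2)) (dv : ℕ) :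
    WeakCertified H dv ∅ :=
  ⟨dv + 1, 0, 1, ∅, one_pos, Nat.zero_le _, by omega,
    ⟨by simp [IsCheckMatching], by simp, by simp, by simp [nbrs]⟩,
    dualFeasible_likelihood_empty H 1⟩

/-! ### The polytope and its symmetry -/

variable {x : Fin n → ℝ} {c : Fin n → ZMod 2}

theorem toReal_eq_zero_or_one (c : Fin n → ZMod 2) (i : Fin n) :
    toReal c i = 0 ∨ toReal c i = 1 := by
  have hc : c i = 0 ∨ c i = 1 := by generalize c i = a; revert a; decide
  exact hc.imp (fun h => by simp [toReal, h]) fun h => by simp [toReal, h, ZMod.val_one]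

theorem toReal_mem_Icc (c : Fin n → ZMod 2) : toReal c ∈ Set.Icc 0 1 := by
  constructor <;> intro i <;> rcases toReal_eq_zero_or_one c i with h | h <;> simp [h]

theorem toReal_add_one_apply (c : Fin n → ZMod 2) (i : Fin n) :
    ((c i + 1).val : ℝ) = 1 - toReal c i := by
  have h : ∀ a : ZMod 2, (a + 1).val + a.val = 1 := by decide
  rw [toReal, eq_sub_iff_add_eq]
  exact_mod_cast h (c i)

theorem toReal_add (c c' : Fin n → ZMod 2) :
    toReal (c + c') = (1 - 2 * toReal c) * toReal c' + toReal c := by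
  have h : ∀ a b : ZMod 2, (a + b).val + 2 * a.val * b.val = b.val + a.val := by decide
  funext i
  have hi : (((c i + c' i).val + 2 * (c i).val * (c' i).val : ℕ) : ℝ) =
      ((c' i).val + (c i).val : ℕ) := congrArg _ (h (c i) (c' i))
  push_cast at hi
  simp only [toReal, Pi.add_apply, Pi.mul_apply, Pi.sub_apply, Pi.ofNat_apply]
  linarith

theorem IsCodeword.mem_polytope (hc : IsCodeword H c) : toReal c ∈ polytope H :=
  Set.mem_iInter.2 fun j => subset_convexHull ℝ _ ⟨c, congrFun hc j, rfl⟩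

theorem polytope_subset_Icc [NeZero m] (H : Matrix (Fin m) (Fin n) (ZMod 2)) :
    polytope H ⊆ Set.Icc 0 1 := by
  refine (Set.iInter_subset _ 0).trans (convexHull_min ?_ (convex_Icc _ _))
  rintro _ ⟨c, -, rfl⟩
  exact toReal_mem_Icc c

theorem isCompact_polytope [NeZero m] (H : Matrix (Fin m) (Fin n) (ZMod 2)) :
    IsCompact (polytope H) := by
  have hcompact : ∀ j, IsCompact (convexHull ℝ (toReal '' {c | H j ⬝ᵥ c = 0})) :=
    fun j => ((Set.toFinite _).image _).isCompact_convexHull ℝ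
  exact (hcompact 0).of_isClosed_subset (isClosed_iInter fun j => (hcompact j).isClosed)
    (Set.iInter_subset _ 0)

/-- The reflection of the cube that exchanges `0` and `1` in the coordinates where `c` is `1`. On
binary words it is addition of `c`, and on the cube it is the vector of distances to `c`. -/
def reflection (c : Fin n → ZMod 2) : (Fin n → ℝ) →ᵃ[ℝ] (Fin n → ℝ) :=
  (LinearMap.mulLeft ℝ (1 - 2 * toReal c)).toAffineMap + AffineMap.const ℝ _ (toReal c)

theorem reflection_toReal (c c' : Fin n → ZMod 2) :
    reflection c (toReal c') = toReal (c + c') :=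
  (toReal_add c c').symm

theorem reflection_eq_abs_sub (c : Fin n → ZMod 2) (hx : x ∈ Set.Icc 0 1) :
    reflection c x = |x - toReal c| := by
  funext i
  have h0 : 0 ≤ x i := hx.1 i
  have h1 : x i ≤ 1 := hx.2 i
  change (1 - 2 * toReal c i) * x i + toReal c i = |x i - toReal c i|
  rcases toReal_eq_zero_or_one c i with h | h <;> rw [h]
  · rw [sub_zero, abs_of_nonneg h0]; ring
  · rw [abs_of_nonpos (sub_nonpos.2 h1)]; ring

theorem IsCodeword.mapsTo_reflection (hc : IsCodeword H c) :
    Set.MapsTo (reflection c) (polytope H) (polytope H) := by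
  refine fun x hx => Set.mem_iInter.2 fun j => ?_
  refine convexHull_min ?_ ((convex_convexHull ℝ _).affine_preimage (reflection c))
    (Set.mem_iInter.1 hx j)
  rintro _ ⟨c', hc', rfl⟩
  refine subset_convexHull ℝ _ ⟨c + c', ?_, (reflection_toReal c c').symm⟩
  have hcj : H j ⬝ᵥ c = 0 := congrFun hc j
  have hcj' : H j ⬝ᵥ c' = 0 := hc'
  rw [Set.mem_ofPred_eq, dotProduct_add, hcj, hcj', add_zero]

theorem val_le_sum_erase_val {ι : Type*} [DecidableEq ι] {s : Finset ι} {e : ι → ZMod 2}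
    (he : ∑ k ∈ s, e k = 0) {i : ι} (hi : i ∈ s) : (e i).val ≤ ∑ k ∈ s.erase i, (e k).val := by
  have hei : e i = ∑ k ∈ s.erase i, e k := by
    rw [← Finset.add_sum_erase _ _ hi] at he
    exact CharTwo.add_eq_zero.1 he
  rw [hei]
  exact Finset.le_sum_of_subadditive ZMod.val ZMod.val_zero.le ZMod.val_add_le _ _

theorem dotProduct_eq_sum_variablesOf (H : Matrix (Fin m) (Fin n) (ZMod 2)) (j : Fin m)
    (c : Fin n → ZMod 2) : H j ⬝ᵥ c = ∑ i ∈ variablesOf H j, c i := by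
  have h : ∀ a b : ZMod 2, a * b = if a ≠ 0 then b else 0 := by decide
  simp only [dotProduct, variablesOf, Finset.sum_filter, h]

theorem inFundamentalCone_of_mem_polytope [NeZero m] (hx : x ∈ polytope H) :
    InFundamentalCone H x := by
  refine ⟨(polytope_subset_Icc H hx).1, fun j i hi => ?_⟩
  have hconvex : Convex ℝ {z : Fin n → ℝ | z i - ∑ k ∈ (variablesOf H j).erase i, z k ≤ 0} := by
    let f : (Fin n → ℝ) →ₗ[ℝ] ℝ :=
      .proj (φ := fun _ => ℝ) i - ∑ k ∈ (variablesOf H j).erase i, .proj (φ := fun _ => ℝ) k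
    simpa [f] using convex_halfSpace_le f.isLinear 0
  refine sub_nonpos.1 (convexHull_min ?_ hconvex (Set.mem_iInter.1 hx j))
  rintro _ ⟨c, hc, rfl⟩
  have hsum : ∑ i ∈ variablesOf H j, c i = 0 := dotProduct_eq_sum_variablesOf H j c ▸ hc
  have hval := val_le_sum_erase_val hsum hi
  simp only [toReal, Set.mem_ofPred_eq, sub_nonpos]
  exact_mod_cast hval

theorem IsCodeword.inFundamentalCone_abs_sub [NeZero m] (hc : IsCodeword H c)
    (hx : x ∈ polytope H) : InFundamentalCone H |x - toReal c| := by
  rw [← reflection_eq_abs_sub c (polytope_subset_Icc H hx)]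
  exact inFundamentalCone_of_mem_polytope (hc.mapsTo_reflection hx)

/-! ### The linear programs -/

theorem abs_sub_received_apply (c : Fin n → ZMod 2) (S : Finset (Fin n)) (hx : x ∈ Set.Icc 0 1)
    (i : Fin n) : |(x - toReal (received c S)) i| =
      if i ∈ S then 1 - |x - toReal c| i else |x - toReal c| i := by
  rw [Pi.sub_apply, Pi.abs_apply, Pi.sub_apply]
  split_ifs with hi
  · have h0 : 0 ≤ x i := hx.1 i
    have h1 : x i ≤ 1 := hx.2 i
    have hy : toReal (received c S) i = 1 - toReal c i := by
      rw [toReal, received, if_pos hi, toReal_add_one_apply]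
    rw [hy]
    rcases toReal_eq_zero_or_one c i with h | h <;> rw [h]
    · rw [abs_of_nonpos (by linarith), sub_zero, sub_zero, abs_of_nonneg h0, neg_sub]
    · rw [sub_self, sub_zero, abs_of_nonneg h0, abs_of_nonpos (by linarith)]
      ring
  · rw [toReal, toReal, received, if_neg hi]

theorem lpSolutions_eq_weightedSolutions_empty (H : Matrix (Fin m) (Fin n) (ZMod 2))
    (y : Fin n → ℝ) : lpSolutions H y = weightedSolutions H (-1) 1 ∅ y := by
  simp [lpSolutions, weightedSolutions, l1On]

theorem weighted_objective_received (c : Fin n → ZMod 2) (S L : Finset (Fin n))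
    (hx : x ∈ Set.Icc 0 1) :
    -1 * l1On L (x - toReal (received c S)) + 1 * l1On Lᶜ (x - toReal (received c S)) =
      -1 * l1On L (toReal c - toReal (received c S)) +
        1 * l1On Lᶜ (toReal c - toReal (received c S)) +
      (∑ i ∈ (symmDiff L S)ᶜ, |x - toReal c| i - ∑ i ∈ symmDiff L S, |x - toReal c| i) := by
  have hsum : ∀ (A : Finset (Fin n)) (f : Fin n → ℝ),
      ∑ i ∈ A, f i = ∑ i, if i ∈ A then f i else 0 := fun A f => by
    rw [Finset.sum_ite_mem, Finset.univ_inter]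
  rw [l1On, l1On, l1On, l1On, hsum L, hsum Lᶜ, hsum L, hsum Lᶜ, hsum (symmDiff L S)ᶜ,
    hsum (symmDiff L S)]
  simp only [abs_sub_received_apply c S hx,
    abs_sub_received_apply c S (toReal_mem_Icc c), Finset.mul_sum, ← Finset.sum_add_distrib,
    ← Finset.sum_sub_distrib]
  refine Finset.sum_congr rfl fun i _ => ?_
  by_cases hL : i ∈ L <;> by_cases hS : i ∈ S <;>
    simp [hL, hS, Finset.mem_symmDiff] <;> ring

theorem sum_abs_sub_le_of_mem_weightedSolutions [NeZero m] {L : Finset (Fin n)}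
    (hc : IsCodeword H c) (hx : x ∈ weightedSolutions H (-1) 1 L (toReal (received c S))) :
    ∑ i ∈ (symmDiff L S)ᶜ, |x - toReal c| i ≤ ∑ i ∈ symmDiff L S, |x - toReal c| i := by
  have hopt := hx.2 _ hc.mem_polytope
  beta_reduce at hopt
  rw [weighted_objective_received c S L (polytope_subset_Icc H hx.1)] at hopt
  linarith

theorem weightedSolutions_nonempty [NeZero m] (hc : IsCodeword H c) (lam₁ lam₂ : ℝ)
    (L : Finset (Fin n)) (y : Fin n → ℝ) : (weightedSolutions H lam₁ lam₂ L y).Nonempty := by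
  have hcont : Continuous fun x => lam₁ * l1On L (x - y) + lam₂ * l1On Lᶜ (x - y) := by
    unfold l1On
    fun_prop
  obtain ⟨x, hx, hmin⟩ := (isCompact_polytope H).exists_isMinOn ⟨_, hc.mem_polytope⟩
    hcont.continuousOn
  exact ⟨x, hx, hmin⟩

theorem IsCodeword.eq_of_mem_polytope_of_sum_le [NeZero m] (hc : IsCodeword H c)
    (h : FundamentalConeProperty H S C) (hC : 1 < C) (hx : x ∈ polytope H)
    (hle : ∑ i ∈ Sᶜ, |x - toReal c| i ≤ ∑ i ∈ S, |x - toReal c| i) : x = toReal c :=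
  funext fun i => sub_eq_zero.1 <| abs_eq_zero.1 <|
    congrFun (h.eq_zero hC (hc.inFundamentalCone_abs_sub hx) hle) i

theorem FundamentalConeProperty.weightedSolutions_eq [NeZero m] {L : Finset (Fin n)}
    (h : FundamentalConeProperty H (symmDiff L S) C) (hC : 1 < C) (hc : IsCodeword H c) :
    weightedSolutions H (-1) 1 L (toReal (received c S)) = {toReal c} :=
  Set.eq_singleton_iff_nonempty_unique_mem.2 ⟨weightedSolutions_nonempty hc _ _ _ _, fun _ hx =>
    hc.eq_of_mem_polytope_of_sum_le h hC hx.1 (sum_abs_sub_le_of_mem_weightedSolutions hc hx)⟩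

theorem exists_isLargestEntries (ℓ : ℕ) (d : Fin n → ℝ) : ∃ L, IsLargestEntries ℓ d L := by
  set σ := Tuple.sort fun i => -|d i|
  have hσ : Monotone fun r => -|d (σ r)| := Tuple.monotone_sort fun i => -|d i|
  refine ⟨(Finset.univ.filter fun r : Fin n => (r : ℕ) < ℓ).map σ.toEmbedding, ?_, ?_⟩
  · rw [Finset.card_map, Fin.card_filter_val_lt, min_comm]
  · intro i hi j hj
    simp only [Finset.mem_map_equiv, Finset.mem_filter, Finset.mem_univ, true_and, not_lt] at hi hj
    have h := hσ (Fin.le_def.2 (hi.le.trans hj))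
    simpa using h

theorem corrects_of_lpSolutions [NeZero m] {ℓ : ℕ} {lam₁ lam₂ : ℝ}
    (hint : ∀ c, IsCodeword H c → ∀ x ∈ lpSolutions H (toReal (received c S)),
      IsIntegral x → x = toReal c)
    (hweight : ∀ c, IsCodeword H c → ∀ x ∈ lpSolutions H (toReal (received c S)),
      ∀ L, IsLargestEntries ℓ (toReal (received c S) - x) L →
        weightedSolutions H lam₁ lam₂ L (toReal (received c S)) = {toReal c}) :
    Corrects H ℓ lam₁ lam₂ S := by
  intro c hc
  refine Set.eq_singleton_iff_nonempty_unique_mem.2 ⟨?_, ?_⟩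
  · obtain ⟨x, hx⟩ : (lpSolutions H (toReal (received c S))).Nonempty := by
      rw [lpSolutions_eq_weightedSolutions_empty]
      exact weightedSolutions_nonempty hc _ _ _ _
    by_cases hxint : IsIntegral x
    · exact ⟨x, x, hx, Or.inl ⟨hxint, rfl⟩⟩
    · obtain ⟨L, hL⟩ := exists_isLargestEntries ℓ (toReal (received c S) - x)
      exact ⟨toReal c, x, hx, Or.inr ⟨hxint, L, hL, hweight c hc x hx L hL ▸ rfl⟩⟩
  · rintro z ⟨x, hx, ⟨hxint, rfl⟩ | ⟨-, L, hL, hz⟩⟩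
    · exact hint c hc z hx hxint
    · rwa [hweight c hc x hx L hL] at hz

theorem FundamentalConeProperty.lpSolutions_eq [NeZero m]
    (h : FundamentalConeProperty H S C) (hC : 1 < C) (hc : IsCodeword H c) :
    lpSolutions H (toReal (received c S)) = {toReal c} := by
  rw [lpSolutions_eq_weightedSolutions_empty]
  exact FundamentalConeProperty.weightedSolutions_eq ((bot_symmDiff S).symm ▸ h) hC hc

theorem corrects_of_lpSolutions_eq {ℓ : ℕ} {lam₁ lam₂ : ℝ}
    (h : ∀ c, IsCodeword H c → lpSolutions H (toReal (received c S)) = {toReal c}) :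
    Corrects H ℓ lam₁ lam₂ S := by
  intro c hc
  have hint : IsIntegral (toReal c) := toReal_eq_zero_or_one c
  simp [decoderOutputs, h c hc, hint]

theorem FundamentalConeProperty.corrects [NeZero m] (h : FundamentalConeProperty H S C)
    (hC : 1 < C) (ℓ : ℕ) (lam₁ lam₂ : ℝ) : Corrects H ℓ lam₁ lam₂ S :=
  corrects_of_lpSolutions_eq fun _ hc => h.lpSolutions_eq hC hc

theorem corrects_empty (H : Matrix (Fin m) (Fin n) (ZMod 2)) (ℓ : ℕ) (lam₁ lam₂ : ℝ) :
    Corrects H ℓ lam₁ lam₂ ∅ := by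
  refine corrects_of_lpSolutions_eq fun c hc => ?_
  have hreceived : received c ∅ = c := by funext i; simp [received]
  have hzero : l1On Finset.univ (toReal c - toReal c) = 0 := by simp [l1On]
  rw [hreceived]
  refine Set.eq_singleton_iff_unique_mem.2 ⟨⟨hc.mem_polytope, fun z _ => ?_⟩, fun x hx => ?_⟩
  · exact hzero.trans_le (Finset.sum_nonneg fun i _ => abs_nonneg _)
  · have hle := (hx.2 _ hc.mem_polytope).trans_eq hzero
    have heq := (Finset.sum_eq_zero_iff_of_nonneg fun i _ => abs_nonneg _).1
      (hle.antisymm (Finset.sum_nonneg fun i _ => abs_nonneg _))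
    exact funext fun i => sub_eq_zero.1 (abs_eq_zero.1 (heq i (Finset.mem_univ i)))

/-! ### Error sets that contain a good set -/

theorem mul_card_filter_le_sum {ι : Type*} [Fintype ι] {w : ι → ℝ} (hw : ∀ i, 0 ≤ w i) (a : ℝ) :
    a * (Finset.univ.filter fun i => a ≤ w i).card ≤ ∑ i, w i := by
  rw [mul_comm, ← nsmul_eq_mul]
  exact (Finset.card_nsmul_le_sum _ w a fun i hi => (Finset.mem_filter.1 hi).2).trans
    (Finset.sum_le_univ_sum_of_nonneg hw)

theorem abs_sub_toReal_mem_Icc (hx : x ∈ Set.Icc 0 1) (c : Fin n → ZMod 2) :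
    |x - toReal c| ∈ Set.Icc 0 1 := by
  refine ⟨abs_nonneg _, fun i => abs_sub_le_iff.2 ⟨?_, ?_⟩⟩ <;>
    linarith [hx.1 i, hx.2 i, (toReal_mem_Icc c).1 i, (toReal_mem_Icc c).2 i,
      show (0 : Fin n → ℝ) i = 0 from rfl, show (1 : Fin n → ℝ) i = 1 from rfl]

theorem FundamentalConeProperty.sum_abs_sub_le_of_mem_lpSolutions [NeZero m]
    (h : FundamentalConeProperty H S' C) (hC : 1 < C) (hS : S' ⊆ S) (hc : IsCodeword H c)
    (hx : x ∈ lpSolutions H (toReal (received c S))) :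
    ∑ i, |x - toReal c| i ≤ 2 * ((C + 1) / (C - 1)) * (S \ S').card := by
  have hcone := h _ (hc.inFundamentalCone_abs_sub hx.1)
  have hle : ∑ i ∈ Sᶜ, |x - toReal c| i ≤ ∑ i ∈ S, |x - toReal c| i := by
    rw [lpSolutions_eq_weightedSolutions_empty] at hx
    simpa only [← Finset.bot_eq_empty, bot_symmDiff] using
      sum_abs_sub_le_of_mem_weightedSolutions hc hx
  have hbad : ∑ i ∈ S \ S', |x - toReal c| i ≤ (S \ S').card := by
    simpa only [nsmul_one] using Finset.sum_le_card_nsmul (S \ S') (|x - toReal c|) 1 fun i _ =>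
      (abs_sub_toReal_mem_Icc (polytope_subset_Icc H hx.1) c).2 i
  have hSsum := Finset.sum_sdiff (f := |x - toReal c|) hS
  have hsum := Finset.sum_add_sum_compl S (|x - toReal c|)
  have hsum' := Finset.sum_add_sum_compl S' (|x - toReal c|)
  have hgood : (C - 1) * ∑ i ∈ S', |x - toReal c| i ≤ 2 * ∑ i ∈ S \ S', |x - toReal c| i := by
    linarith
  rw [← mul_div_assoc, div_mul_eq_mul_div, le_div_iff₀' (sub_pos.2 hC)]
  calc (C - 1) * ∑ i, |x - toReal c| i
      ≤ (C - 1) * (2 * (∑ i ∈ S', |x - toReal c| i + ∑ i ∈ S \ S', |x - toReal c| i)) :=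
        mul_le_mul_of_nonneg_left (by linarith) (sub_pos.2 hC).le
    _ ≤ 2 * (C + 1) * ∑ i ∈ S \ S', |x - toReal c| i := by linarith [hgood]
    _ ≤ 2 * (C + 1) * (S \ S').card := mul_le_mul_of_nonneg_left hbad (by linarith)

theorem card_sdiff_le_of_isLargestEntries {ℓ : ℕ} {L : Finset (Fin n)} (hx : x ∈ Set.Icc 0 1)
    (hSℓ : S.card ≤ ℓ) (hL : IsLargestEntries ℓ (toReal (received c S) - x) L) :
    ((S \ L).card : ℝ) ≤ 2 * ∑ i, |x - toReal c| i := by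
  have hmarkov := mul_card_filter_le_sum (w := |x - toReal c|) (fun i => abs_nonneg _) (1 / 2)
  suffices (S \ L).card ≤ (Finset.univ.filter fun i => 1 / 2 ≤ |x - toReal c| i).card by
    have : ((S \ L).card : ℝ) ≤ (Finset.univ.filter fun i => 1 / 2 ≤ |x - toReal c| i).card := by
      exact_mod_cast this
    linarith
  have habs : ∀ i, |(toReal (received c S) - x) i| =
      if i ∈ S then 1 - |x i - toReal c i| else |x i - toReal c i| := fun i => by
    rw [← neg_sub, Pi.neg_apply, abs_neg]
    exact abs_sub_received_apply c S hx i
  -- An index of `S` with a small error that `L` misses forces large errors on all of `L \ S`.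
  by_cases hsmall : ∃ i ∈ S \ L, |x i - toReal c i| < 1 / 2
  · obtain ⟨i, hi, hlt⟩ := hsmall
    obtain ⟨hiS, hiL⟩ := Finset.mem_sdiff.1 hi
    have hcard : S.card ≤ L.card := by
      rw [hL.1]
      exact le_min hSℓ (by simpa using S.card_le_univ)
    have hsub : L \ S ⊆ Finset.univ.filter fun k => 1 / 2 ≤ |x k - toReal c k| := fun k hk => by
      obtain ⟨hkL, hkS⟩ := Finset.mem_sdiff.1 hk
      have hik := hL.2 k hkL i hiL
      rw [habs, habs, if_pos hiS, if_neg hkS] at hik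
      exact Finset.mem_filter.2 ⟨Finset.mem_univ k, by linarith⟩
    exact (Finset.card_sdiff_le_card_sdiff_iff.2 hcard).trans (Finset.card_le_card hsub)
  · push Not at hsmall
    exact Finset.card_le_card fun i hi => by simpa using hsmall i hi

theorem IsLargestEntries.card_symmDiff_le {ℓ : ℕ} {d : Fin n → ℝ} {L : Finset (Fin n)}
    (hL : IsLargestEntries ℓ d L) :
    ((symmDiff L S).card : ℝ) ≤ ℓ - S.card + 2 * (S \ L).card := by
  have hLℓ : L.card ≤ ℓ := hL.1.trans_le (min_le_left _ _)
  have hdisj : (symmDiff L S).card = (L \ S).card + (S \ L).card :=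
    Finset.card_union_of_disjoint disjoint_sdiff_sdiff
  have hL' := Finset.card_sdiff_add_card_inter L S
  have hS' := Finset.card_sdiff_add_card_inter S L
  rw [Finset.inter_comm] at hS'
  have hnat : (symmDiff L S).card + S.card ≤ ℓ + 2 * (S \ L).card := by omega
  rw [sub_add_eq_add_sub, le_sub_iff_add_le]
  exact_mod_cast hnat

theorem IsCodeword.eq_of_isIntegral [NeZero m] (hc : IsCodeword H c) (hC : 1 < C)
    (hx : x ∈ polytope H) (hint : IsIntegral x)
    (h : ∀ U : Finset (Fin n), (U.card : ℝ) ≤ 2 * ∑ i, |x - toReal c| i →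
      FundamentalConeProperty H U C) : x = toReal c := by
  have hmarkov := mul_card_filter_le_sum (w := |x - toReal c|) (fun i => abs_nonneg _) (1 / 2)
  refine hc.eq_of_mem_polytope_of_sum_le
    (h (Finset.univ.filter fun i => 1 / 2 ≤ |x - toReal c| i) (by linarith)) hC hx ?_
  rw [Finset.sum_eq_zero]
  · exact Finset.sum_nonneg fun i _ => abs_nonneg _
  · intro i hi
    have hlt : |x i - toReal c i| < 1 / 2 := by simpa using hi
    change |x i - toReal c i| = 0
    rcases hint i with hxi | hxi <;> rcases toReal_eq_zero_or_one c i with hci | hci <;>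
      rw [hxi, hci] at hlt ⊢ <;> norm_num at hlt <;> norm_num

/-- The LP solution is close to the codeword because `S'` is good and `S \ S'` is small, so `L` is
close to `S`, and the reweighted LP is a plain LP with the small error set `L ∆ S`. -/
theorem corrects_of_fundamentalConeProperty_subset [NeZero m] {ℓ : ℕ} {r : ℝ} (hC : 1 < C)
    (hr : ∀ U : Finset (Fin n), (U.card : ℝ) ≤ r → FundamentalConeProperty H U C)
    (hS : S' ⊆ S) (hS' : FundamentalConeProperty H S' C) (hSℓ : S.card ≤ ℓ)
    (hℓ : 8 * ((C + 1) / (C - 1)) * (ℓ - S'.card) ≤ r) : Corrects H ℓ (-1) 1 S := by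
  set κ := (C + 1) / (C - 1) with hκ
  have hκ1 : 1 ≤ κ := by
    rw [hκ, one_le_div (sub_pos.2 hC)]
    linarith
  have hcard : ((S \ S').card : ℝ) = S.card - S'.card := by
    rw [Finset.card_sdiff_of_subset hS, Nat.cast_sub (Finset.card_le_card hS)]
  have hSℓ' : (S.card : ℝ) ≤ ℓ := by exact_mod_cast hSℓ
  have hclose : ∀ c, IsCodeword H c → ∀ x ∈ lpSolutions H (toReal (received c S)),
      ∑ i, |x - toReal c| i ≤ 2 * κ * (S.card - S'.card) := fun c hc x hx =>
    hcard ▸ hS'.sum_abs_sub_le_of_mem_lpSolutions hC hS hc hx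
  have hsub : 0 ≤ κ * (S.card - S'.card) :=
    mul_nonneg (by linarith) (sub_nonneg.2 (by exact_mod_cast Finset.card_le_card hS))
  have hexcess : (ℓ : ℝ) - S.card ≤ κ * (ℓ - S.card) :=
    le_mul_of_one_le_left (sub_nonneg.2 hSℓ') hκ1
  refine corrects_of_lpSolutions (fun c hc x hx hint => ?_) fun c hc x hx L hL => ?_
  · refine hc.eq_of_isIntegral hC hx.1 hint fun U hU => hr U ?_
    linarith [hclose c hc x hx]
  · refine FundamentalConeProperty.weightedSolutions_eq (hr _ ?_) hC hc
    have hmiss := card_sdiff_le_of_isLargestEntries (polytope_subset_Icc H hx.1) hSℓ hL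
    linarith [hclose c hc x hx, hL.card_symmDiff_le (S := S)]

/-! ### Fractions of error sets -/

theorem card_div_choose_le_card_falling_div_choose {α : Type*} [DecidableEq α] [Fintype α]
    {𝓑 : Finset (Finset α)} {a b : ℕ} (hab : a ≤ b) (h𝓑 : (𝓑 : Set (Finset α)).Sized b) :
    (𝓑.card : ℝ) / (Fintype.card α).choose b ≤
      (𝓑.falling a).card / (Fintype.card α).choose a := by
  induction hab using Nat.decreasingInduction with
  | self =>
    gcongr
    exact fun B hB => Finset.mem_falling.2 ⟨⟨B, hB, Finset.Subset.refl B⟩, h𝓑 hB⟩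
  | of_succ k _ ih =>
    refine ih.trans ((Finset.local_lubell_yamamoto_meshalkin_inequality_div k.succ_ne_zero
      (Finset.sized_falling _ _)).trans ?_)
    rw [Nat.succ_sub_one]
    gcongr
    rw [← Finset.slice_union_shadow_falling_succ k 𝓑]
    exact Finset.subset_union_right

theorem failFraction_nonneg (n k : ℕ) (Q : Finset (Fin n) → Prop) : 0 ≤ failFraction n k Q := by
  unfold failFraction
  positivity

theorem failFraction_le_of_subset {Q R : Finset (Fin n) → Prop} {a b : ℕ} (hab : a ≤ b)
    (h : ∀ A B, A.card = a → B.card = b → A ⊆ B → Q A → R B) :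
    failFraction n b R ≤ failFraction n a Q := by
  classical
  have hlym := card_div_choose_le_card_falling_div_choose hab
    (𝓑 := (Finset.univ.powersetCard b).filter fun B => ¬R B)
    fun B hB => (Finset.mem_powersetCard.1 (Finset.mem_filter.1 hB).1).2
  rw [Fintype.card_fin] at hlym
  unfold failFraction
  refine hlym.trans ?_
  gcongr
  intro A hA
  obtain ⟨⟨B, hB, hAB⟩, hAcard⟩ := Finset.mem_falling.1 hA
  simp only [Finset.mem_filter, Finset.mem_powersetCard_univ] at hB ⊢
  exact ⟨hAcard, fun hQ => hB.2 (h A B hAcard hB.1 hAB hQ)⟩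

theorem failFraction_compl {k : ℕ} (hk : k ≤ n) (Q : Finset (Fin n) → Prop) :
    failFraction n (n - k) (fun S => Q Sᶜ) = failFraction n k Q := by
  classical
  unfold failFraction
  rw [Nat.choose_symm hk]
  congr 2
  refine Finset.card_nbij' compl compl ?_ ?_ (fun _ _ => compl_compl _) fun _ _ => compl_compl _
  all_goals
    intro S hS
    simp only [Finset.coe_filter, Finset.mem_powersetCard_univ, Set.mem_ofPred_eq,
      Finset.card_compl, Fintype.card_fin, compl_compl] at hS ⊢
    exact ⟨by omega, hS.2⟩

theorem failFraction_le_of_superset {Q R : Finset (Fin n) → Prop} {a b : ℕ} (hab : a ≤ b)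
    (hb : b ≤ n) (h : ∀ A B, A.card = a → B.card = b → A ⊆ B → R B → Q A) :
    failFraction n a Q ≤ failFraction n b R := by
  rw [← failFraction_compl hb, ← failFraction_compl (hab.trans hb)]
  refine failFraction_le_of_subset (Nat.sub_le_sub_left hab n) fun A B hA hB hAB hR =>
    h Bᶜ Aᶜ ?_ ?_ (Finset.compl_subset_compl.2 hAB) hR
  · rw [Finset.card_compl, Fintype.card_fin, hB]
    omega
  · rw [Finset.card_compl, Fintype.card_fin, hA]
    omega

/-! ### Below and beyond the thresholds -/

section Thresholds

variable {M N : ℕ → ℕ} {H : ∀ t, Matrix (Fin (M t)) (Fin (N t)) (ZMod 2)} {p : ℝ}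

theorem strongThreshold_nonneg (dv : ℕ) (M N : ℕ → ℕ)
    (H : ∀ t, Matrix (Fin (M t)) (Fin (N t)) (ZMod 2)) : 0 ≤ strongThreshold dv M N H :=
  Real.sSup_nonneg fun _ hp => hp.1

theorem strongThreshold_le_one (dv : ℕ) (M N : ℕ → ℕ)
    (H : ∀ t, Matrix (Fin (M t)) (Fin (N t)) (ZMod 2)) : strongThreshold dv M N H ≤ 1 :=
  Real.sSup_le (fun _ hp => hp.2.1) zero_le_one

theorem weakThreshold_le_one (dv : ℕ) (M N : ℕ → ℕ)
    (H : ∀ t, Matrix (Fin (M t)) (Fin (N t)) (ZMod 2)) : weakThreshold dv M N H ≤ 1 :=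
  Real.sSup_le (fun _ hp => hp.2.1) zero_le_one

theorem floor_mul_le_of_le_one (hp : p ≤ 1) (n : ℕ) : ⌊p * n⌋₊ ≤ n :=
  Nat.floor_le_of_le (mul_le_of_le_one_left (Nat.cast_nonneg n) hp)

theorem eventually_fundamentalConeProperty_of_lt_strongThreshold
    (hdeg : ∀ t i, (checksOf (H t) i).card ≤ dv) (hp : p < strongThreshold dv M N H) :
    ∀ᶠ t in atTop, ∀ S : Finset (Fin (N t)), S.card ≤ ⌊p * N t⌋₊ →
      FundamentalConeProperty (H t) S (1 + 1 / (dv + 1)) := by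
  obtain ⟨p', ⟨-, hp'1, hp'⟩, hpp'⟩ := exists_lt_of_lt_csSup (by
    refine ⟨0, le_rfl, zero_le_one, .of_forall fun t S hS => ?_⟩
    obtain rfl : S = ∅ := by simpa using hS
    exact strongCertified_empty (H t) dv) hp
  filter_upwards [hp'] with t hcert S hS
  have hfloor : ⌊p * N t⌋₊ ≤ ⌊p' * N t⌋₊ := by gcongr
  obtain ⟨S', hSS', hS'⟩ := Finset.exists_superset_card_eq (hS.trans hfloor)
    (by simpa using floor_mul_le_of_le_one hp'1 (N t))
  exact ((hcert S' hS').fundamentalConeProperty (hdeg t)).mono (by positivity) hSS'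

theorem tendsto_failFraction_fundamentalConeProperty_of_lt_weakThreshold
    (hdeg : ∀ t i, (checksOf (H t) i).card ≤ dv) (hp : p < weakThreshold dv M N H) {k : ℕ → ℕ}
    (hk : ∀ t, k t ≤ ⌊p * N t⌋₊) :
    Tendsto (fun t => failFraction (N t) (k t)
      fun S => FundamentalConeProperty (H t) S (1 + 1 / (dv + 1))) atTop (𝓝 0) := by
  obtain ⟨p', ⟨-, hp'1, hp'⟩, hpp'⟩ := exists_lt_of_lt_csSup (by
    refine ⟨0, le_rfl, zero_le_one, tendsto_const_nhds.congr fun t => ?_⟩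
    simp [failFraction, weakCertified_empty, Finset.filter_singleton]) hp
  refine squeeze_zero (fun t => failFraction_nonneg _ _ _) (fun t => ?_) hp'
  have hfloor : ⌊p * N t⌋₊ ≤ ⌊p' * N t⌋₊ := by gcongr
  exact failFraction_le_of_superset ((hk t).trans hfloor) (floor_mul_le_of_le_one hp'1 (N t))
    fun S S' _ _ hSS' hcert =>
      (hcert.fundamentalConeProperty (hdeg t)).mono (by positivity) hSS'

end Thresholds

theorem corrects_of_min_card_le {s q ε : ℝ} (hC : 1 < C)
    (hr : ∀ U : Finset (Fin n), (U.card : ℝ) ≤ s * n → FundamentalConeProperty H U C)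
    (hn : 16 * ((C + 1) / (C - 1)) ≤ s * n) (hε : 0 ≤ ε) (hεs : 32 * ((C + 1) / (C - 1)) * ε ≤ s)
    (hq : q ≤ 1) (hS : S' ⊆ S) (hS' : FundamentalConeProperty H S' C)
    (hcard' : min S.card ⌊(q - ε) * n⌋₊ ≤ S'.card) (hcard : (S.card : ℝ) ≤ (1 + ε) * q * n) :
    Corrects H ⌊(1 + ε) * q * n⌋₊ (-1) 1 S := by
  rcases S.eq_empty_or_nonempty with rfl | hne
  · exact corrects_empty _ _ _ _
  have hκ : 1 ≤ (C + 1) / (C - 1) := by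
    rw [one_le_div (sub_pos.2 hC)]
    linarith
  obtain ⟨i, -⟩ := hne
  have hsingle : FundamentalConeProperty H {i} C := hr _ <| by
    rw [Finset.card_singleton, Nat.cast_one]
    linarith
  have := hsingle.neZero (one_pos.trans hC) (Finset.singleton_nonempty i)
  rcases min_le_iff.1 hcard' with hle | hle
  · rw [← Finset.eq_of_subset_of_card_le hS hle]
    exact hS'.corrects hC _ _ _
  · refine corrects_of_fundamentalConeProperty_subset hC hr hS hS' (Nat.le_floor hcard) ?_
    generalize (C + 1) / (C - 1) = κ at *
    have hℓ : (⌊(1 + ε) * q * n⌋₊ : ℝ) ≤ (1 + ε) * q * n :=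
      Nat.floor_le ((Nat.cast_nonneg _).trans hcard)
    have hS'card : (q - ε) * n - 1 ≤ S'.card :=
      (Nat.sub_one_lt_floor _).le.trans (by exact_mod_cast hle)
    have hgap : (⌊(1 + ε) * q * n⌋₊ : ℝ) - S'.card ≤ 2 * ε * n + 1 := by
      nlinarith [mul_nonneg hε (mul_nonneg (sub_nonneg.2 hq) n.cast_nonneg)]
    calc 8 * κ * ((⌊(1 + ε) * q * n⌋₊ : ℝ) - S'.card) ≤ 8 * κ * (2 * ε * n + 1) := by gcongr
      _ = 32 * κ * ε * n / 2 + 16 * κ / 2 := by ring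
      _ ≤ s * n / 2 + s * n / 2 := by gcongr
      _ = s * n := add_halves _

theorem exists_eventually_corrects {M N : ℕ → ℕ}
    {H : ∀ t, Matrix (Fin (M t)) (Fin (N t)) (ZMod 2)} {s : ℝ} (hN : Tendsto N atTop atTop)
    (hC : 1 < C) (hs : 0 < s) (hr : ∀ᶠ t in atTop, ∀ U : Finset (Fin (N t)),
      U.card ≤ ⌊s * N t⌋₊ → FundamentalConeProperty (H t) U C) :
    ∃ ε : ℝ, 0 < ε ∧ ∀ q ≤ 1, ∀ᶠ t in atTop, ∀ S S' : Finset (Fin (N t)), S' ⊆ S →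
      FundamentalConeProperty (H t) S' C → min S.card ⌊(q - ε) * N t⌋₊ ≤ S'.card →
      (S.card : ℝ) ≤ (1 + ε) * q * N t → Corrects (H t) ⌊(1 + ε) * q * N t⌋₊ (-1) 1 S := by
  have : 0 < (C + 1) / (C - 1) := div_pos (by linarith) (sub_pos.2 hC)
  have hlarge : Tendsto (fun t => s * (N t : ℝ)) atTop atTop :=
    (tendsto_natCast_atTop_atTop.comp hN).const_mul_atTop hs
  refine ⟨s / (32 * ((C + 1) / (C - 1))), by positivity, fun q hq => ?_⟩
  filter_upwards [hr, hlarge.eventually_ge_atTop (16 * ((C + 1) / (C - 1)))] with t hr hn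
    S S' hS hS' hcard' hcard
  exact corrects_of_min_card_le hC (fun U hU => hr U (Nat.le_floor hU)) hn (by positivity)
    (mul_div_cancel₀ _ (by positivity)).le hq hS hS' hcard' hcard

end ReweightedLP

open ReweightedLP in
theorem mainTheorem1_general (dv : ℕ) (M N : ℕ → ℕ)
    (H : ∀ t, Matrix (Fin (M t)) (Fin (N t)) (ZMod 2)) (hN : Tendsto N atTop atTop)
    (hdeg : ∀ t i, (checksOf (H t) i).card ≤ dv) :
    ∃ ε : ℝ, 0 < ε ∧
      (∀ᶠ t in atTop, ∀ S : Finset (Fin (N t)),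
        (S.card : ℝ) ≤ (1 + ε) * strongThreshold dv M N H * N t →
        Corrects (H t) ⌊(1 + ε) * strongThreshold dv M N H * N t⌋₊ (-1) 1 S) ∧
      (0 < strongThreshold dv M N H → ∀ k : ℕ → ℕ,
        (∀ t, (k t : ℝ) ≤ (1 + ε) * weakThreshold dv M N H * N t) →
        Tendsto (fun t => failFraction (N t) (k t)
          (Corrects (H t) ⌊(1 + ε) * weakThreshold dv M N H * N t⌋₊ (-1) 1)) atTop (𝓝 0)) := by
  rcases (strongThreshold_nonneg dv M N H).eq_or_lt with hs | hs
  · refine ⟨1, one_pos, .of_forall fun t S hS => ?_, fun h => (h.ne hs).elim⟩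
    obtain rfl : S = ∅ := by simpa [← hs] using hS
    exact corrects_empty _ _ _ _
  obtain ⟨ε, hε, hcorrects⟩ := exists_eventually_corrects hN
    (lt_add_of_pos_right 1 (by positivity)) (half_pos hs)
    (eventually_fundamentalConeProperty_of_lt_strongThreshold hdeg (half_lt_self hs))
  refine ⟨ε, hε, ?_, fun _ k hk => ?_⟩
  · filter_upwards [hcorrects _ (strongThreshold_le_one dv M N H),
      eventually_fundamentalConeProperty_of_lt_strongThreshold hdeg (sub_lt_self _ hε)]
      with t hcorrects hgood S hS
    obtain ⟨S', hS', hcard⟩ := Finset.exists_subset_card_eq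
      (min_le_left S.card ⌊(strongThreshold dv M N H - ε) * N t⌋₊)
    exact hcorrects S S' hS' (hgood S' (hcard.trans_le (min_le_right _ _))) hcard.ge hS
  · refine squeeze_zero' (.of_forall fun t => failFraction_nonneg _ _ _) ?_
      (tendsto_failFraction_fundamentalConeProperty_of_lt_weakThreshold hdeg (sub_lt_self _ hε)
        fun t => min_le_right (k t) _)
    filter_upwards [hcorrects _ (weakThreshold_le_one dv M N H)] with t hcorrects
    exact failFraction_le_of_subset (min_le_left _ _) fun A B hA hB hAB hgood =>
      hcorrects B A hAB hgood (by rw [hA, hB]) (hB ▸ hk t)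

theorem mainTheorem1 (dv : ℕ) (M N : ℕ → ℕ)
    (H : ∀ t, Matrix (Fin (M t)) (Fin (N t)) (ZMod 2))
    (hN : Tendsto N atTop atTop)
    (hreg : ∀ t, ReweightedLP.VariableRegular (H t) dv) :
    ∃ ε₁ ε₂ lam₁ lam₂ : ℝ, 0 < ε₁ ∧ 0 < ε₂ ∧ lam₁ < 0 ∧ 0 < lam₂ ∧
      (∀ᶠ t in atTop, ∀ S : Finset (Fin (N t)),
        (S.card : ℝ) ≤ (1 + ε₁) * ReweightedLP.strongThreshold dv M N H * N t →
        ReweightedLP.Corrects (H t)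
          ⌊(1 + ε₁) * ReweightedLP.strongThreshold dv M N H * N t⌋₊ lam₁ lam₂ S) ∧
      (0 < ReweightedLP.strongThreshold dv M N H →
        ∀ k : ℕ → ℕ,
          (∀ t, (k t : ℝ) ≤ (1 + ε₂) * ReweightedLP.weakThreshold dv M N H * N t) →
          Tendsto (fun t => ReweightedLP.failFraction (N t) (k t)
            (ReweightedLP.Corrects (H t)
              ⌊(1 + ε₂) * ReweightedLP.weakThreshold dv M N H * N t⌋₊ lam₁ lam₂))
            atTop (𝓝 0)) := by
  obtain ⟨ε, hε, hstrong, hweak⟩ := mainTheorem1_general dv M N H hN fun t i => (hreg t i).le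
  exact ⟨ε, ε, -1, 1, hε, hε, neg_one_lt_zero, one_pos, hstrong, hweak⟩
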